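/- Let $A$ be a (not necessarily unital) $C^*$-algebra and $E$ a Hilbert $C^*$-module over $A$. Let $L(E)$ be the algebra of bounded adjointable operators on $E$, and $K(E)\subseteq L(E)$ the closed linear span of the operators $z\mapsto x\langle y,z\rangle$, $x,y\in E$. A closed densely defined $A$-linear operator $t:D(t)\subseteq E\to E$ with densely defined adjoint $t^*$ is called regular if $1+t^*t$ has dense range. An operator $G\in L(E)$ is a pseudo left (resp. right) inverse of $t$ if $Gt$ (resp. $tG$), on its natural domain, is closable, its closure belongs to $L(E)$, and this closure is congruent to $1$ modulo $K(E)$. A regular operator is called Fredholm if it has both a pseudo left inverse and a pseudo right inverse. Proposition. Let $t$ be a regular Fredholm operator on $E$. Then there exists $\varepsilon>0$ such that, for every bounded adjointable operator $D$ on $E$ with $\|D\|\le\varepsilon$, the operator $D+t$ (with domain $D(t)$) is a regular Fredholm operator on $E$. -/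

import Mathlib

/- Operators on Hilbert C⋆-modules.  Mathlib's `CStarModule A E` is a module `E` over a
C⋆-algebra `A` (possibly non-unital) with an `A`-valued inner product `inner A x y` that is
linear in the second variable, whose norm is `‖x‖ = √‖inner A x x‖`; a Hilbert C⋆-module is such an
`E` that is complete. -/

noncomputable section

namespace HilbertCMod

/-- The composition `g ∘ f` of partially defined operators, on its natural domain
`{x ∈ D(f) | f x ∈ D(g)}`. -/
def pcomp {E : Type*} [AddCommGroup E] [Module ℂ E] (g f : E →ₗ.[ℂ] E) : E →ₗ.[ℂ] E where
  domain :=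
    { carrier := {x | ∃ h : x ∈ f.domain, f ⟨x, h⟩ ∈ g.domain}
      zero_mem' := ⟨f.domain.zero_mem, by
        have h : f ⟨0, f.domain.zero_mem⟩ = 0 := f.map_zero
        rw [h]; exact g.domain.zero_mem⟩
      add_mem' := by
        rintro x y ⟨hx, hx'⟩ ⟨hy, hy'⟩
        refine ⟨f.domain.add_mem hx hy, ?_⟩
        have h : f ⟨x + y, f.domain.add_mem hx hy⟩ = f ⟨x, hx⟩ + f ⟨y, hy⟩ :=
          f.map_add ⟨x, hx⟩ ⟨y, hy⟩
        rw [h]; exact g.domain.add_mem hx' hy'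
      smul_mem' := by
        rintro c x ⟨hx, hx'⟩
        refine ⟨f.domain.smul_mem c hx, ?_⟩
        have h : f ⟨c • x, f.domain.smul_mem c hx⟩ = c • f ⟨x, hx⟩ := f.map_smul c ⟨x, hx⟩
        rw [h]; exact g.domain.smul_mem c hx' }
  toFun :=
    { toFun := fun x => g ⟨f ⟨x.1, x.2.1⟩, x.2.2⟩
      map_add' := fun x y => by
        rw [← g.map_add]
        congr 1
        exact Subtype.ext (f.map_add ⟨x.1, x.2.1⟩ ⟨y.1, y.2.1⟩)
      map_smul' := fun c x => by
        rw [RingHom.id_apply, ← g.map_smul]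
        congr 1
        exact Subtype.ext (f.map_smul c ⟨x.1, x.2.1⟩) }

theorem mem_pcomp_domain {E : Type*} [AddCommGroup E] [Module ℂ E] (g f : E →ₗ.[ℂ] E) (x : E) :
    x ∈ (pcomp g f).domain ↔ ∃ h : x ∈ f.domain, f ⟨x, h⟩ ∈ g.domain := Iff.rfl

theorem pcomp_apply {E : Type*} [AddCommGroup E] [Module ℂ E] (g f : E →ₗ.[ℂ] E)
    (x : (pcomp g f).domain) : pcomp g f x = g ⟨f ⟨x.1, x.2.1⟩, x.2.2⟩ := rfl

/-- An everywhere defined bounded operator, regarded as a partially defined one. -/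
def everywhere {E : Type*} [NormedAddCommGroup E] [NormedSpace ℂ E] (T : E →L[ℂ] E) :
    E →ₗ.[ℂ] E :=
  (T : E →ₗ[ℂ] E).toPMap ⊤

section

variable (A : Type*) {E : Type*} [NonUnitalCStarAlgebra A] [PartialOrder A] [StarOrderedRing A]
  [NormedAddCommGroup E] [NormedSpace ℂ E] [SMul A E] [CStarModule A E]

/-- `t` is a module map: its domain is a submodule over `A` and `t` is `A`-linear on it. -/
def IsModuleMap (t : E →ₗ.[ℂ] E) : Prop :=
  ∀ (a : A) (x : t.domain), ∃ h : a • (x : E) ∈ t.domain, t ⟨a • (x : E), h⟩ = a • t x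

/-- Bounded adjointable operators: the elements of `L(E)`. -/
def IsAdjointable (T : E →L[ℂ] E) : Prop :=
  ∃ S : E →L[ℂ] E, ∀ x y : E, inner A (T x) y = inner A x (S y)

/-- The set of all pairs `(y, z)` with `⟨t x, y⟩ = ⟨x, z⟩` for every `x ∈ D(t)`. -/
def adjointGraph (t : E →ₗ.[ℂ] E) : Submodule ℂ (E × E) where
  carrier := {p | ∀ x : t.domain, inner A (t x) p.1 = inner A (x : E) p.2}
  zero_mem' := fun x => by simp
  add_mem' := fun {p q} hp hq x => by
    simp only [Prod.fst_add, Prod.snd_add, CStarModule.inner_add_right, hp x, hq x]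
  smul_mem' := fun c p hp x => by
    simp only [Prod.smul_fst, Prod.smul_snd, CStarModule.inner_smul_right_complex, hp x]

/-- The adjoint `t*` of a densely defined operator `t`: its domain consists of those `y` for which
some `z` satisfies `⟨t x, y⟩ = ⟨x, z⟩` for all `x ∈ D(t)`, and then `t* y = z`. -/
def adjoint (t : E →ₗ.[ℂ] E) : E →ₗ.[ℂ] E := (adjointGraph A t).toLinearPMap

theorem adjoint_graph (t : E →ₗ.[ℂ] E) (ht : Dense (t.domain : Set E)) :
    (adjoint A t).graph = adjointGraph A t := by
  refine Submodule.toLinearPMap_graph_eq _ ?_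
  rintro ⟨y, z⟩ h rfl
  have h0 : ∀ x ∈ (t.domain : Set E), inner A x z = 0 := fun x hx => by
    have := h ⟨x, hx⟩
    simpa using this.symm
  have hc : Continuous fun x : E => inner A x z :=
    (CStarModule.continuous_inner (A := A) (E := E)).comp (continuous_id.prodMk continuous_const)
  have h1 := Continuous.ext_on ht hc continuous_const h0
  exact (CStarModule.inner_self (A := A)).1 (congrFun h1 z)

/-- Regular operators: closed densely defined module maps `t` with densely defined adjoint such
that `1 + t* t`, with domain `D(t* t)`, has dense range. -/
structure IsRegular (t : E →ₗ.[ℂ] E) : Prop where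
  isModuleMap : IsModuleMap A t
  isClosed : t.IsClosed
  dense_domain : Dense (t.domain : Set E)
  dense_adjoint_domain : Dense ((adjoint A t).domain : Set E)
  dense_range : Dense (Set.range ((LinearMap.id : E →ₗ[ℂ] E) +ᵥ pcomp (adjoint A t) t))

theorem ext_inner {x y : E} (h : ∀ w : E, inner A w x = inner A w y) : x = y := by
  have h1 : inner A (x - y) (x - y) = (0 : A) := by
    rw [CStarModule.inner_sub_right, h, sub_self]
  exact sub_eq_zero.1 ((CStarModule.inner_self (A := A)).1 h1)

theorem add_smul_right (a b : A) (x : E) : (a + b) • x = a • x + b • x :=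
  ext_inner A fun w => by simp [add_mul]

theorem smul_smul_right (c : ℂ) (a : A) (x : E) : (c • a) • x = c • (a • x) :=
  ext_inner A fun w => by simp [smul_mul_assoc]

theorem norm_smul_le_mul (a : A) (x : E) : ‖a • x‖ ≤ ‖a‖ * ‖x‖ := by
  have h : ‖a • x‖ ^ 2 ≤ (‖a‖ * ‖x‖) ^ 2 := by
    rw [CStarModule.norm_sq_eq A, mul_pow, CStarModule.norm_sq_eq A (x := x)]
    simp only [CStarModule.inner_op_smul_right, CStarModule.inner_op_smul_left]
    calc ‖a * (inner A x x * star a)‖ ≤ ‖a‖ * (‖inner A x x‖ * ‖star a‖) :=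
          (norm_mul_le _ _).trans (by gcongr; exact norm_mul_le _ _)
      _ = ‖a‖ ^ 2 * ‖inner A x x‖ := by rw [norm_star]; ring
  exact (pow_le_pow_iff_left₀ (norm_nonneg _) (by positivity) two_ne_zero).1 h

/-- The elementary operator `θ_{x,y} : z ↦ ⟨y, z⟩ x`. -/
def rankOne (x y : E) : E →L[ℂ] E :=
  LinearMap.mkContinuous
    { toFun := fun z => (inner A y z : A) • x
      map_add' := fun z w => by rw [CStarModule.inner_add_right, add_smul_right]
      map_smul' := fun c z => by
        rw [CStarModule.inner_smul_right_complex, smul_smul_right, RingHom.id_apply] }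
    (‖y‖ * ‖x‖) (fun z => by
      refine (norm_smul_le_mul A _ x).trans ?_
      have := CStarModule.norm_inner_le (A := A) E (x := y) (y := z)
      calc ‖(inner A y z : A)‖ * ‖x‖ ≤ (‖y‖ * ‖z‖) * ‖x‖ := by gcongr
        _ = ‖y‖ * ‖x‖ * ‖z‖ := by ring)

/-- `K(E)`: the closed linear span of the elementary operators. -/
def compactOperators : Submodule ℂ (E →L[ℂ] E) :=
  (Submodule.span ℂ (Set.range fun p : E × E => rankOne A p.1 p.2)).topologicalClosure

/-- The partially defined operator `s` is closable, its closure is an everywhere defined bounded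
adjointable operator, and that operator is congruent to `1` modulo `K(E)`. -/
def ClosureCongrOne (s : E →ₗ.[ℂ] E) : Prop :=
  s.IsClosable ∧ ∃ T : E →L[ℂ] E, IsAdjointable A T ∧ s.closure = everywhere T ∧
    T - ContinuousLinearMap.id ℂ E ∈ compactOperators A

/-- `G` is a pseudo left inverse of `t`. -/
def IsPseudoLeftInverse (G : E →L[ℂ] E) (t : E →ₗ.[ℂ] E) : Prop :=
  IsAdjointable A G ∧ ClosureCongrOne A (pcomp (everywhere G) t)

/-- `G` is a pseudo right inverse of `t`. -/
def IsPseudoRightInverse (G : E →L[ℂ] E) (t : E →ₗ.[ℂ] E) : Prop :=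
  IsAdjointable A G ∧ ClosureCongrOne A (pcomp t (everywhere G))

/-- Regular Fredholm operators. -/
def IsRegularFredholm (t : E →ₗ.[ℂ] E) : Prop :=
  IsRegular A t ∧ (∃ G : E →L[ℂ] E, IsPseudoLeftInverse A G t) ∧
    ∃ G : E →L[ℂ] E, IsPseudoRightInverse A G t

end

end HilbertCMod

end

namespace HilbertCMod

noncomputable section

/-! ### Perturbation of surjections, closures and graphs in Banach spaces. -/

section general

variable {X : Type*} [NormedAddCommGroup X] [NormedSpace ℂ X]

/-! Regularity is a complementation property of graphs. The graph of `t` and the rotated graph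
`{(-z, y)}` of `t*` are orthogonal, so the sum map `graphSum` is bounded below on pairs
(`norm_le_of_mem_graphProd`). For regular `t` it is also surjective
(`IsRegular.surjective_graphSum`), and surjectivity gives back the density of the range of `1 + t*t`
(`dense_range_of_surjective_graphSum`). Replacing `t` by `D + t` changes the sum map by at most
`2‖D‖` relative to its own size, so surjectivity survives (`surjective_add_of_norm_le`).

Pseudo inverses are corrected by Neumann series: if `G` is a pseudo left inverse of `t`, then `(1 +
GD)⁻¹ G` is one of `D + t`; on the right, `G (1 + DG)⁻¹` works. The error stays in `K(E)` because
`K(E)` is an ideal of `L(E)`. -/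

theorem isUnit_one_add_of_norm_lt_one [CompleteSpace X] {F : X →L[ℂ] X} (hF : ‖F‖ < 1) :
    IsUnit (1 + F) := by
  have h := isUnit_one_sub_of_norm_lt_one (x := -F) (by rwa [norm_neg])
  rwa [sub_neg_eq_add] at h

/-- A surjective linear map stays surjective under perturbations that are strictly smaller. -/
theorem surjective_add_of_norm_le [CompleteSpace X] {V : Type*} [AddCommGroup V] [Module ℂ V]
    {f g : V →ₗ[ℂ] X} (hf : Function.Surjective f) {c : ℝ} (hc0 : 0 ≤ c) (hc : c < 1)
    (hg : ∀ v, ‖g v‖ ≤ c * ‖f v‖) : Function.Surjective (f + g) := by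
  -- The linear section `h` need not be continuous; only `g ∘ h` has to be bounded, and it has norm
  -- at most `c < 1`.
  obtain ⟨h, hh⟩ := f.exists_rightInverse_of_surjective (LinearMap.range_eq_top.2 hf)
  have hfh : ∀ w, f (h w) = w := fun w => LinearMap.congr_fun hh w
  let F : X →L[ℂ] X := (g ∘ₗ h).mkContinuous c fun w => by
    simpa only [LinearMap.comp_apply, hfh] using hg (h w)
  have hF : ‖F‖ < 1 := (LinearMap.mkContinuous_norm_le _ hc0 _).trans_lt hc
  obtain ⟨R, hR⟩ := (isUnit_one_add_of_norm_lt_one hF).exists_right_inv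
  intro w
  refine ⟨h (R w), ?_⟩
  have hw : R w + g (h (R w)) = w := congrArg (fun T : X →L[ℂ] X => T w) hR
  rw [LinearMap.add_apply, hfh, hw]

theorem mem_graph_everywhere (T : X →L[ℂ] X) (p : X × X) :
    p ∈ (everywhere T).graph ↔ T p.1 = p.2 := by
  rw [LinearPMap.mem_graph_iff]
  constructor
  · rintro ⟨x, hx, hx'⟩
    rw [← hx', ← hx]
    rfl
  · exact fun h => ⟨⟨p.1, Submodule.mem_top⟩, rfl, h⟩

theorem isClosed_graph_everywhere (T : X →L[ℂ] X) :
    IsClosed ((everywhere T).graph : Set (X × X)) := by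
  have h : ((everywhere T).graph : Set (X × X)) = {p | T p.1 = p.2} :=
    Set.ext fun p => mem_graph_everywhere T p
  rw [h]
  exact isClosed_eq (by fun_prop) (by fun_prop)

theorem closure_eq_everywhere {s : X →ₗ.[ℂ] X} (hs : Dense (s.domain : Set X)) (T : X →L[ℂ] X)
    (hT : ∀ x : s.domain, s x = T x) : s.IsClosable ∧ s.closure = everywhere T := by
  have hg : s.graph.topologicalClosure = (everywhere T).graph := by
    refine le_antisymm (Submodule.topologicalClosure_minimal _ ?_ (isClosed_graph_everywhere T)) ?_
    · intro p hp
      obtain ⟨x, hx, hx'⟩ := (LinearPMap.mem_graph_iff s).1 hp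
      rw [mem_graph_everywhere, ← hx, ← hx', hT]
    · rintro ⟨x, y⟩ hp
      rw [mem_graph_everywhere] at hp
      obtain rfl : T x = y := hp
      refine map_mem_closure (f := fun x => (x, T x)) (by fun_prop) (hs x) ?_
      intro z hz
      have := s.mem_graph ⟨z, hz⟩
      rwa [hT] at this
  have hc : s.IsClosable := ⟨_, hg⟩
  exact ⟨hc, LinearPMap.eq_of_eq_graph (hc.graph_closure_eq_closure_graph.symm.trans hg)⟩

theorem apply_eq_of_closure_eq_everywhere {s : X →ₗ.[ℂ] X} {T : X →L[ℂ] X}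
    (h : s.closure = everywhere T) (x : s.domain) : s x = T x := by
  have h1 := (LinearPMap.le_graph_iff.2 (LinearPMap.le_closure s)) (s.mem_graph x)
  rw [h, mem_graph_everywhere] at h1
  exact h1.symm

/-- Closedness of `t` makes `tG` everywhere defined: if `(xₙ, tGxₙ)` tends to `(x, Tx)`, then `(Gxₙ,
tGxₙ)` tends to `(Gx, Tx)` inside the graph of `t`. -/
theorem apply_of_closure_pcomp_right {t : X →ₗ.[ℂ] X} (ht : t.IsClosed) {G T : X →L[ℂ] X}
    (hc : (pcomp t (everywhere G)).IsClosable)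
    (h : (pcomp t (everywhere G)).closure = everywhere T) (x : X) :
    ∃ hx : G x ∈ t.domain, t ⟨G x, hx⟩ = T x := by
  have h1 : (x, T x) ∈ closure ((pcomp t (everywhere G)).graph : Set (X × X)) := by
    have h2 : (x, T x) ∈ (everywhere T).graph := (mem_graph_everywhere T _).2 rfl
    rw [← h, ← hc.graph_closure_eq_closure_graph] at h2
    exact h2
  have h3 : (G x, T x) ∈ closure (t.graph : Set (X × X)) := by
    refine map_mem_closure (f := fun p : X × X => (G p.1, p.2)) (by fun_prop) h1 ?_
    intro p hp
    obtain ⟨y, hy, hy'⟩ := (LinearPMap.mem_graph_iff _).1 hp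
    have := t.mem_graph ⟨_, y.2.2⟩
    change (G p.1, p.2) ∈ t.graph
    rw [← hy, ← hy']
    exact this
  rw [IsClosed.closure_eq ht] at h3
  obtain ⟨y, hy, hy'⟩ := (LinearPMap.mem_graph_iff _).1 h3
  obtain ⟨y, hyd⟩ := y
  obtain rfl : y = G x := hy
  exact ⟨hyd, hy'⟩

theorem mem_graph_vadd (D : X →ₗ[ℂ] X) (t : X →ₗ.[ℂ] X) (p : X × X) :
    p ∈ (D +ᵥ t).graph ↔ (p.1, p.2 - D p.1) ∈ t.graph := by
  rw [LinearPMap.mem_graph_iff, LinearPMap.mem_graph_iff]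
  constructor
  · rintro ⟨y, hy, hy'⟩
    refine ⟨y, hy, ?_⟩
    rw [← hy', ← hy, LinearPMap.vadd_apply, add_sub_cancel_left]
  · rintro ⟨y, hy, hy'⟩
    refine ⟨y, hy, ?_⟩
    rw [LinearPMap.vadd_apply, hy', hy, add_sub_cancel]

theorem isClosed_vadd (D : X →L[ℂ] X) {t : X →ₗ.[ℂ] X} (ht : t.IsClosed) :
    ((D : X →ₗ[ℂ] X) +ᵥ t).IsClosed := by
  have h : (((D : X →ₗ[ℂ] X) +ᵥ t).graph : Set (X × X)) =
      (fun p : X × X => (p.1, p.2 - D p.1)) ⁻¹' t.graph :=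
    Set.ext fun p => mem_graph_vadd _ t p
  unfold LinearPMap.IsClosed
  rw [h]
  exact IsClosed.preimage (by fun_prop) ht

end general

section

variable {A E : Type*} [NonUnitalCStarAlgebra A] [PartialOrder A] [StarOrderedRing A]
  [NormedAddCommGroup E] [NormedSpace ℂ E] [SMul A E] [CStarModule A E]

/-! ### Bounded adjointable operators and the ideal `K(E)`. -/

theorem norm_adjoint_apply_le {T S : E →L[ℂ] E} (h : ∀ x y : E, inner A (T x) y = inner A x (S y))
    (y : E) : ‖S y‖ ≤ ‖T‖ * ‖y‖ := by
  have h1 : ‖S y‖ ^ 2 ≤ ‖T‖ * ‖S y‖ * ‖y‖ := by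
    rw [CStarModule.norm_sq_eq A, ← h]
    refine (CStarModule.norm_inner_le E).trans ?_
    gcongr
    exact T.le_opNorm _
  rcases (norm_nonneg (S y)).eq_or_lt with h0 | h0
  · rw [← h0]
    positivity
  · refine le_of_mul_le_mul_left ?_ h0
    calc ‖S y‖ * ‖S y‖ = ‖S y‖ ^ 2 := (pow_two _).symm
      _ ≤ _ := h1
      _ = _ := by ring

theorem inner_adjoint_left {T S : E →L[ℂ] E} (h : ∀ x y : E, inner A (T x) y = inner A x (S y))
    (x y : E) : (inner A (S x) y : A) = inner A x (T y) := by
  rw [← CStarModule.star_inner, ← h, CStarModule.star_inner]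

theorem IsAdjointable.map_smul {T : E →L[ℂ] E} (hT : IsAdjointable A T) (a : A) (x : E) :
    T (a • x) = a • T x := by
  obtain ⟨S, hS⟩ := hT
  refine ext_inner A fun w => ?_
  rw [← inner_adjoint_left hS, CStarModule.inner_op_smul_right, CStarModule.inner_op_smul_right,
    inner_adjoint_left hS]

theorem IsAdjointable.add {T U : E →L[ℂ] E} (hT : IsAdjointable A T) (hU : IsAdjointable A U) :
    IsAdjointable A (T + U) := by
  obtain ⟨S, hS⟩ := hT
  obtain ⟨R, hR⟩ := hU
  exact ⟨S + R, fun x y => by simp [hS, hR]⟩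

theorem IsAdjointable.mul {T U : E →L[ℂ] E} (hT : IsAdjointable A T) (hU : IsAdjointable A U) :
    IsAdjointable A (T * U) := by
  obtain ⟨S, hS⟩ := hT
  obtain ⟨R, hR⟩ := hU
  exact ⟨R * S, fun x y => by simp [hS, hR]⟩

variable (A) in
/-- For `‖F‖ < 1` the operator `1 + F` is invertible in `L(E)`. -/
theorem IsAdjointable.exists_inverse_one_add [CompleteSpace E] {F : E →L[ℂ] E}
    (hF : IsAdjointable A F) (h1 : ‖F‖ < 1) :
    ∃ W : E →L[ℂ] E, IsAdjointable A W ∧ W * (1 + F) = 1 ∧ (1 + F) * W = 1 := by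
  obtain ⟨S, hS⟩ := hF
  have hS1 : ‖S‖ < 1 :=
    (S.opNorm_le_bound (norm_nonneg F) (norm_adjoint_apply_le hS)).trans_lt h1
  obtain ⟨W, hW, hW'⟩ := isUnit_iff_exists.1 (isUnit_one_add_of_norm_lt_one h1)
  obtain ⟨V, hV⟩ := (isUnit_one_add_of_norm_lt_one hS1).exists_right_inv
  -- The adjoint of `(1 + F)⁻¹` is `V = (1 + F*)⁻¹`, which exists since `‖F*‖ ≤ ‖F‖`.
  refine ⟨W, ⟨V, fun x y => ?_⟩, hW', hW⟩
  have hx : W x + F (W x) = x := congrArg (fun T : E →L[ℂ] E => T x) hW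
  have hy : V y + S (V y) = y := congrArg (fun T : E →L[ℂ] E => T y) hV
  calc (inner A (W x) y : A) = inner A (W x) (V y + S (V y)) := by rw [hy]
    _ = inner A (W x + F (W x)) (V y) := by
      rw [CStarModule.inner_add_right, CStarModule.inner_add_left, hS]
    _ = inner A x (V y) := by rw [hx]

theorem compactOperators_le_comap {f : (E →L[ℂ] E) →L[ℂ] (E →L[ℂ] E)}
    (hf : ∀ x y : E, f (rankOne A x y) ∈ Set.range fun p : E × E => rankOne A p.1 p.2)
    {k : E →L[ℂ] E} (hk : k ∈ compactOperators A) : f k ∈ compactOperators A := by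
  refine map_mem_closure f.continuous hk ?_
  intro l hl
  have h : Submodule.span ℂ (Set.range fun p : E × E => rankOne A p.1 p.2) ≤
      (Submodule.span ℂ (Set.range fun p : E × E => rankOne A p.1 p.2)).comap
        (f : (E →L[ℂ] E) →ₗ[ℂ] (E →L[ℂ] E)) := by
    rw [Submodule.span_le]
    rintro _ ⟨p, rfl⟩
    exact Submodule.subset_span (hf p.1 p.2)
  exact h hl

theorem IsAdjointable.mul_mem_compactOperators {T k : E →L[ℂ] E} (hT : IsAdjointable A T)
    (hk : k ∈ compactOperators A) : T * k ∈ compactOperators A := by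
  refine compactOperators_le_comap (f := ContinuousLinearMap.mul ℂ (E →L[ℂ] E) T) ?_ hk
  intro x y
  -- `T θ_{x,y} = θ_{Tx,y}`.
  refine ⟨(T x, y), ?_⟩
  ext z
  exact (hT.map_smul _ _).symm

theorem IsAdjointable.compactOperators_mul_mem {T k : E →L[ℂ] E} (hT : IsAdjointable A T)
    (hk : k ∈ compactOperators A) : k * T ∈ compactOperators A := by
  refine compactOperators_le_comap
    (f := (ContinuousLinearMap.mul ℂ (E →L[ℂ] E)).flip T) ?_ hk
  obtain ⟨S, hS⟩ := hT
  intro x y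
  -- `θ_{x,y} T = θ_{x,T*y}`.
  refine ⟨(x, S y), ?_⟩
  ext z
  change (inner A (S y) z : A) • x = (inner A y (T z) : A) • x
  rw [inner_adjoint_left hS]

/-! ### Pseudo inverses of the perturbed operator. -/

variable (A) in
-- With `T` the closure of `Gt` and `W = (1 + GD)⁻¹`, the closure of `WG(D + t)` is `W(GD + T) = 1 +
-- W(T - 1)`.
theorem IsPseudoLeftInverse.vadd [CompleteSpace E] {G : E →L[ℂ] E} {t : E →ₗ.[ℂ] E}
    (htd : Dense (t.domain : Set E)) (hG : IsPseudoLeftInverse A G t) {D : E →L[ℂ] E}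
    (hD : IsAdjointable A D) (h1 : ‖G‖ * ‖D‖ < 1) :
    ∃ G' : E →L[ℂ] E, IsPseudoLeftInverse A G' ((D : E →ₗ[ℂ] E) +ᵥ t) := by
  obtain ⟨hGa, hc, T, hTa, hT, hTk⟩ := hG
  obtain ⟨W, hWa, hW, -⟩ :=
    (hGa.mul hD).exists_inverse_one_add A ((norm_mul_le G D).trans_lt h1)
  have hdom : (pcomp (everywhere (W * G)) ((D : E →ₗ[ℂ] E) +ᵥ t)).domain = t.domain :=
    le_antisymm (fun x hx => hx.1) fun x hx => ⟨hx, Submodule.mem_top⟩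
  obtain ⟨hc', hT'⟩ := closure_eq_everywhere (s := pcomp (everywhere (W * G)) _)
    (by rwa [hdom]) (W * (G * D + T)) (by
      rintro ⟨x, hx, hx'⟩
      have h2 : G (t ⟨x, hx⟩) = T x :=
        apply_eq_of_closure_eq_everywhere hT ⟨x, hx, Submodule.mem_top⟩
      change W (G (D x + t ⟨x, hx⟩)) = W (G (D x) + T x)
      rw [map_add G, h2])
  refine ⟨W * G, hWa.mul hGa, hc', _, hWa.mul ((hGa.mul hD).add hTa), hT', ?_⟩
  have h3 : W * (G * D + T) - ContinuousLinearMap.id ℂ E =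
      W * (T - ContinuousLinearMap.id ℂ E) := by
    calc W * (G * D + T) - 1 = W * (G * D + T) - W * (1 + G * D) := by rw [hW]
      _ = W * (T - 1) := by noncomm_ring
  rw [h3]
  exact hWa.mul_mem_compactOperators hTk

variable (A) in
-- With `T` the closure of `tG` and `W = (1 + DG)⁻¹`, one gets `(D + t)GW = (DG + T)W = 1 + (T -
-- 1)W`, with no closure needed because `tG` is already everywhere defined.
theorem IsPseudoRightInverse.vadd [CompleteSpace E] {G : E →L[ℂ] E} {t : E →ₗ.[ℂ] E}
    (htc : t.IsClosed) (hG : IsPseudoRightInverse A G t) {D : E →L[ℂ] E}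
    (hD : IsAdjointable A D) (h1 : ‖G‖ * ‖D‖ < 1) :
    ∃ G' : E →L[ℂ] E, IsPseudoRightInverse A G' ((D : E →ₗ[ℂ] E) +ᵥ t) := by
  obtain ⟨hGa, hc, T, hTa, hT, hTk⟩ := hG
  obtain ⟨W, hWa, -, hW⟩ := (hD.mul hGa).exists_inverse_one_add A
    ((norm_mul_le D G).trans_lt (by rwa [mul_comm]))
  have hdom : (pcomp ((D : E →ₗ[ℂ] E) +ᵥ t) (everywhere (G * W))).domain = ⊤ :=
    eq_top_iff.2 fun x _ =>
      ⟨Submodule.mem_top, (apply_of_closure_pcomp_right htc hc hT (W x)).1⟩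
  obtain ⟨hc', hT'⟩ := closure_eq_everywhere (s := pcomp _ (everywhere (G * W)))
    (by rw [hdom]; exact dense_univ) ((D * G + T) * W) (by
      rintro ⟨x, hx, hx'⟩
      obtain ⟨h2, h3⟩ := apply_of_closure_pcomp_right htc hc hT (W x)
      change D (G (W x)) + t ⟨G (W x), h2⟩ = D (G (W x)) + T (W x)
      rw [h3])
  refine ⟨G * W, hGa.mul hWa, hc', _, ((hD.mul hGa).add hTa).mul hWa, hT', ?_⟩
  have h3 : (D * G + T) * W - ContinuousLinearMap.id ℂ E =
      (T - ContinuousLinearMap.id ℂ E) * W := by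
    calc (D * G + T) * W - 1 = (D * G + T) * W - (1 + D * G) * W := by rw [hW]
      _ = (T - 1) * W := by noncomm_ring
  rw [h3]
  exact hWa.compactOperators_mul_mem hTk

/-! ### Regularity through the graphs of `t` and `t*`. -/

variable (A) in
theorem isModuleMap_vadd {D : E →L[ℂ] E} (hD : IsAdjointable A D) {t : E →ₗ.[ℂ] E}
    (ht : IsModuleMap A t) : IsModuleMap A ((D : E →ₗ[ℂ] E) +ᵥ t) := by
  intro a x
  obtain ⟨h, h'⟩ := ht a x
  refine ⟨h, ?_⟩
  change D (a • (x : E)) + t ⟨a • (x : E), h⟩ = a • (D x + t x)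
  rw [h', hD.map_smul]
  -- The action of `A` on `E` is a bare `SMul`, so its additivity in `E` is tested against inner
  -- products.
  refine ext_inner A fun w => ?_
  simp [mul_add]

theorem mem_adjointGraph_vadd {D S : E →L[ℂ] E}
    (hS : ∀ x y : E, inner A (D x) y = inner A x (S y)) {t : E →ₗ.[ℂ] E} {p : E × E}
    (hp : p ∈ adjointGraph A t) :
    (p.1, p.2 + S p.1) ∈ adjointGraph A ((D : E →ₗ[ℂ] E) +ᵥ t) := by
  intro x
  change inner A (D (x : E) + t x) p.1 = inner A (x : E) (p.2 + S p.1)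
  rw [CStarModule.inner_add_left, CStarModule.inner_add_right, hS, hp x, add_comm]

theorem isClosed_adjointGraph (t : E →ₗ.[ℂ] E) : IsClosed (adjointGraph A t : Set (E × E)) := by
  have h : (adjointGraph A t : Set (E × E)) =
      ⋂ x : t.domain, {p | inner A (t x) p.1 = inner A (x : E) p.2} := by
    ext p
    rw [Set.mem_iInter]
    rfl
  rw [h]
  refine isClosed_iInter fun x => isClosed_eq ?_ ?_
  · exact (CStarModule.continuous_inner (A := A) (E := E)).comp
      (continuous_const.prodMk continuous_fst)
  · exact (CStarModule.continuous_inner (A := A) (E := E)).comp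
      (continuous_const.prodMk continuous_snd)

variable (E) in
/-- The sum map `((x, a), (y, z)) ↦ (x, a) + (-z, y)`. -/
def graphSum : ((E × E) × (E × E)) →L[ℂ] E × E :=
  let f := ContinuousLinearMap.fst ℂ (E × E) (E × E)
  let s := ContinuousLinearMap.snd ℂ (E × E) (E × E)
  f + (-(ContinuousLinearMap.snd ℂ E E ∘L s)).prod (ContinuousLinearMap.fst ℂ E E ∘L s)

theorem graphSum_apply (m : (E × E) × (E × E)) :
    graphSum E m = (m.1.1 - m.2.2, m.1.2 + m.2.1) := by
  simp [graphSum, sub_eq_add_neg, Prod.ext_iff]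

variable (A) in
/-- Pairs consisting of an element of the graph of `t` and one of the graph of `t*`. -/
def graphProd (t : E →ₗ.[ℂ] E) : Submodule ℂ ((E × E) × (E × E)) :=
  t.graph.prod (adjointGraph A t)

/-- Pythagoras: the cross terms cancel because `⟨tx, y⟩ = ⟨x, z⟩` for `(y, z)` in the adjoint graph.
-/
theorem inner_graphSum {t : E →ₗ.[ℂ] E} {m : (E × E) × (E × E)} (hm : m ∈ graphProd A t) :
    (inner A (graphSum E m).1 (graphSum E m).1 + inner A (graphSum E m).2 (graphSum E m).2 : A) =
      inner A m.1.1 m.1.1 + inner A m.1.2 m.1.2 + inner A m.2.1 m.2.1 + inner A m.2.2 m.2.2 := by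
  obtain ⟨h1, h2⟩ := hm
  obtain ⟨x, hx, hx'⟩ := (LinearPMap.mem_graph_iff t).1 h1
  have h3 : (inner A m.1.2 m.2.1 : A) = inner A m.1.1 m.2.2 := by
    rw [← hx, ← hx']
    exact h2 x
  have h4 : (inner A m.2.1 m.1.2 : A) = inner A m.2.2 m.1.1 := by
    rw [← CStarModule.star_inner, h3, CStarModule.star_inner]
  rw [graphSum_apply]
  simp only [CStarModule.inner_sub_left, CStarModule.inner_sub_right, CStarModule.inner_add_left,
    CStarModule.inner_add_right, h3, h4]
  abel

/-- By Pythagoras each of the four squares is dominated in `A` by the total. Product spaces carry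
the sup norm, which costs a factor `√2`, rounded up to `2`. -/
theorem norm_le_of_mem_graphProd {t : E →ₗ.[ℂ] E} {m : (E × E) × (E × E)}
    (hm : m ∈ graphProd A t) : ‖m‖ ≤ 2 * ‖graphSum E m‖ := by
  have key : ∀ w : E, (inner A w w : A) ≤ inner A m.1.1 m.1.1 + inner A m.1.2 m.1.2 +
      inner A m.2.1 m.2.1 + inner A m.2.2 m.2.2 → ‖w‖ ≤ 2 * ‖graphSum E m‖ := by
    intro w hw
    rw [← inner_graphSum hm] at hw
    have h1 := CStarAlgebra.norm_le_norm_of_nonneg_of_le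
      (CStarModule.inner_self_nonneg (A := A) (x := w)) hw
    rw [← CStarModule.norm_sq_eq A] at h1
    have h2 := h1.trans (norm_add_le _ _)
    rw [← CStarModule.norm_sq_eq A, ← CStarModule.norm_sq_eq A] at h2
    have h3 := norm_fst_le (graphSum E m)
    have h4 := norm_snd_le (graphSum E m)
    have h5 := norm_nonneg (graphSum E m).1
    have h6 := norm_nonneg (graphSum E m).2
    refine abs_le_of_sq_le_sq' ?_ (by positivity) |>.2
    nlinarith
  have h := fun w : E => CStarModule.inner_self_nonneg (A := A) (x := w)
  have h1 := h m.1.1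
  have h2 := h m.1.2
  have h3 := h m.2.1
  have h4 := h m.2.2
  refine norm_prod_le_iff.2 ⟨norm_prod_le_iff.2 ⟨key _ ?_, key _ ?_⟩,
    norm_prod_le_iff.2 ⟨key _ ?_, key _ ?_⟩⟩
  · rw [add_assoc, add_assoc]
    exact le_add_of_nonneg_right (by positivity)
  · rw [add_assoc, add_comm (inner A m.1.1 m.1.1), add_assoc]
    exact le_add_of_nonneg_right (by positivity)
  · rw [add_assoc, add_left_comm]
    exact le_add_of_nonneg_right (by positivity)
  · exact le_add_of_nonneg_left (by positivity)

variable (A) in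
/-- The graphs of a regular operator and of its adjoint span `E × E`. -/
theorem IsRegular.surjective_graphSum [CompleteSpace E] {t : E →ₗ.[ℂ] E} (ht : IsRegular A t) :
    Function.Surjective ((graphSum E : _ →ₗ[ℂ] E × E).domRestrict (graphProd A t)) := by
  have hcl : IsClosed (graphProd A t : Set ((E × E) × (E × E))) :=
    IsClosed.prod ht.isClosed (isClosed_adjointGraph t)
  have : CompleteSpace (graphProd A t) := hcl.completeSpace_coe
  let J : graphProd A t →L[ℂ] E × E := graphSum E ∘L (graphProd A t).subtypeL
  have hJ : AntilipschitzWith 2 J := J.antilipschitz_of_bound fun m => by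
    exact norm_le_of_mem_graphProd m.2
  -- Bounded below on a complete space, `J` has closed range; a dense set of values therefore
  -- suffices.
  have hr : IsClosed (Set.range J) := hJ.isClosed_range J.uniformContinuous
  have hadj := adjoint_graph A t ht.dense_domain
  have h1 : ∀ (u : E) (v : (adjoint A t).domain), (u, (v : E)) ∈ Set.range J := by
    intro u v
    have h2 : (u, (v : E)) =
        (fun w => (w - adjoint A t v, (v : E))) (u + adjoint A t v) := by simp
    rw [h2, ← hr.closure_eq]
    refine map_mem_closure (f := fun w => (w - adjoint A t v, (v : E))) (by fun_prop)
      (ht.dense_range (u + adjoint A t v)) ?_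
    rintro _ ⟨⟨x, hx, hx'⟩, rfl⟩
    -- For `x ∈ D(t*t)` and `v ∈ D(t*)`, the pairs `(x, tx)` and `(v - tx, t*v - t*tx)` sum to `((1
    -- + t*t)x - t*v, v)`, whose first entry is dense in `E` as `x` varies.
    refine ⟨⟨((x, t ⟨x, hx⟩), ((v : E) - t ⟨x, hx⟩, adjoint A t v - adjoint A t ⟨_, hx'⟩)),
      t.mem_graph ⟨x, hx⟩, ?_⟩, ?_⟩
    · rw [← hadj]
      exact Submodule.sub_mem _ ((adjoint A t).mem_graph v) ((adjoint A t).mem_graph ⟨_, hx'⟩)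
    · change graphSum E _ = _
      rw [graphSum_apply]
      refine Prod.ext ?_ ?_
      · change x - (adjoint A t v - adjoint A t ⟨_, hx'⟩) =
          x + adjoint A t ⟨_, hx'⟩ - adjoint A t v
        abel
      · exact add_sub_cancel _ _
  rintro ⟨u, v⟩
  have h3 : (u, v) ∈ Set.range J := by
    rw [← hr.closure_eq]
    refine map_mem_closure (f := fun v => (u, v)) (by fun_prop) (ht.dense_adjoint_domain v) ?_
    exact fun w hw => h1 u ⟨w, hw⟩
  exact h3

variable (A) in
-- Hitting `(u, 0)` forces `y = -tx`, hence `tx ∈ D(t*)` with `t*tx = -z`, and `u = x - z = (1 +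
-- t*t)x`. So `1 + t*t` is even surjective.
theorem dense_range_of_surjective_graphSum {t : E →ₗ.[ℂ] E} (htd : Dense (t.domain : Set E))
    (h : Function.Surjective ((graphSum E : _ →ₗ[ℂ] E × E).domRestrict (graphProd A t))) :
    Dense (Set.range ((LinearMap.id : E →ₗ[ℂ] E) +ᵥ pcomp (adjoint A t) t)) := by
  refine Function.Surjective.denseRange (fun u => ?_)
  obtain ⟨⟨⟨⟨x, a⟩, ⟨y, z⟩⟩, h1, h2⟩, h3⟩ := h (u, 0)
  have h4 : graphSum E ((x, a), (y, z)) = (u, 0) := h3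
  rw [graphSum_apply] at h4
  obtain ⟨h5, h6⟩ := Prod.mk.inj h4
  obtain ⟨⟨x', hx⟩, rfl, hxa⟩ := (LinearPMap.mem_graph_iff t).1 h1
  have h7 : (t ⟨x', hx⟩, -z) ∈ (adjoint A t).graph := by
    rw [adjoint_graph A t htd]
    have h8 := Submodule.neg_mem _ h2
    have h9 : t ⟨x', hx⟩ = -y := hxa.trans (eq_neg_of_add_eq_zero_left h6)
    rw [h9]
    exact h8
  obtain ⟨⟨w, hw⟩, hwe, hwz⟩ := (LinearPMap.mem_graph_iff _).1 h7
  obtain rfl : w = t ⟨x', hx⟩ := hwe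
  refine ⟨⟨x', hx, hw⟩, ?_⟩
  change x' + adjoint A t ⟨t ⟨x', hx⟩, hw⟩ = u
  rw [hwz, ← h5, ← sub_eq_add_neg]

variable (A) in
/-- Small bounded adjointable perturbations of regular operators are regular. -/
theorem IsRegular.vadd [CompleteSpace E] {t : E →ₗ.[ℂ] E} (ht : IsRegular A t) {D : E →L[ℂ] E}
    (hD : IsAdjointable A D) (hn : 2 * ‖D‖ < 1) : IsRegular A ((D : E →ₗ[ℂ] E) +ᵥ t) where
  isModuleMap := isModuleMap_vadd A hD ht.isModuleMap
  isClosed := isClosed_vadd D ht.isClosed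
  dense_domain := ht.dense_domain
  dense_adjoint_domain := by
    obtain ⟨S, hS⟩ := hD
    -- `D(t*) ⊆ D((D + t)*)`, where the larger adjoint acts as `t* + D*`.
    refine ht.dense_adjoint_domain.mono ?_
    intro y hy
    have h := mem_adjointGraph_vadd hS
      ((adjoint_graph A t ht.dense_domain).le ((adjoint A t).mem_graph ⟨y, hy⟩))
    rw [← adjoint_graph A ((D : E →ₗ[ℂ] E) +ᵥ t) ht.dense_domain] at h
    exact LinearPMap.mem_domain_of_mem_graph h
  dense_range := by
    refine dense_range_of_surjective_graphSum A ht.dense_domain ?_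
    obtain ⟨S, hS⟩ := hD
    -- Moving `(x, tx)` to `(x, Dx + tx)` and `(y, z)` to `(y, z + D*y)` carries the old graphs into
    -- the new ones and changes the sum by exactly `B`.
    let B : ((E × E) × (E × E)) →ₗ[ℂ] E × E :=
      (-((S : E →ₗ[ℂ] E) ∘ₗ LinearMap.fst ℂ E E ∘ₗ LinearMap.snd ℂ (E × E) (E × E))).prod
        ((D : E →ₗ[ℂ] E) ∘ₗ LinearMap.fst ℂ E E ∘ₗ LinearMap.fst ℂ (E × E) (E × E))
    have hB : ∀ m, B m = (-S m.2.1, D m.1.1) := fun m => rfl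
    have hs := surjective_add_of_norm_le (g := B.domRestrict (graphProd A t))
      (ht.surjective_graphSum A) (c := 2 * ‖D‖) (by positivity) hn (by
        intro m
        have h1 : ‖B m‖ ≤ ‖D‖ * ‖(m : (E × E) × (E × E))‖ := by
          rw [hB]
          refine norm_prod_le_iff.2 ⟨?_, ?_⟩
          · rw [norm_neg]
            refine (norm_adjoint_apply_le hS _).trans ?_
            gcongr
            exact (norm_fst_le _).trans (norm_snd_le _)
          · refine (D.le_opNorm _).trans ?_
            gcongr
            exact (norm_fst_le _).trans (norm_fst_le _)
        have h2 := norm_le_of_mem_graphProd m.2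
        calc ‖B m‖ ≤ ‖D‖ * ‖(m : (E × E) × (E × E))‖ := h1
          _ ≤ ‖D‖ * (2 * ‖graphSum E m‖) := by gcongr
          _ = 2 * ‖D‖ * ‖graphSum E m‖ := by ring)
    intro w
    obtain ⟨⟨m, h1, h2⟩, rfl⟩ := hs w
    refine ⟨⟨((m.1.1, D m.1.1 + m.1.2), (m.2.1, m.2.2 + S m.2.1)), ?_, ?_⟩, ?_⟩
    · refine (mem_graph_vadd _ t _).2 ?_
      change (m.1.1, D m.1.1 + m.1.2 - D m.1.1) ∈ t.graph
      rw [add_sub_cancel_left]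
      exact h1
    · exact mem_adjointGraph_vadd hS h2
    · change graphSum E _ = graphSum E m + B m
      rw [graphSum_apply, graphSum_apply, hB]
      refine Prod.ext ?_ ?_
      · change m.1.1 - (m.2.2 + S m.2.1) = m.1.1 - m.2.2 + -S m.2.1
        abel
      · change D m.1.1 + m.1.2 + m.2.1 = m.1.2 + m.2.1 + D m.1.1
        abel

end

end

end HilbertCMod

theorem mainTheorem6 {A E : Type*}
    [NonUnitalCStarAlgebra A] [PartialOrder A] [StarOrderedRing A]
    [NormedAddCommGroup E] [NormedSpace ℂ E] [SMul A E] [CStarModule A E] [CompleteSpace E]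
    (t : E →ₗ.[ℂ] E) (ht : HilbertCMod.IsRegularFredholm A t) :
    ∃ ε : ℝ, 0 < ε ∧ ∀ D : E →L[ℂ] E, HilbertCMod.IsAdjointable A D → ‖D‖ ≤ ε →
      HilbertCMod.IsRegularFredholm A ((D : E →ₗ[ℂ] E) +ᵥ t) := by
  obtain ⟨hr, ⟨G, hG⟩, ⟨H, hH⟩⟩ := ht
  have hpos : 0 < 3 + ‖G‖ + ‖H‖ := by positivity
  -- The constant `3` is `2 + 1`: regularity needs `2‖D‖ < 1`, and the extra `1` makes this and the
  -- bounds on `‖G‖‖D‖` and `‖H‖‖D‖` strict.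
  refine ⟨(3 + ‖G‖ + ‖H‖)⁻¹, inv_pos.2 hpos, fun D hD hn => ?_⟩
  have h1 : (3 + ‖G‖ + ‖H‖) * ‖D‖ ≤ 1 := by
    calc (3 + ‖G‖ + ‖H‖) * ‖D‖ ≤ (3 + ‖G‖ + ‖H‖) * (3 + ‖G‖ + ‖H‖)⁻¹ := by gcongr
      _ = 1 := mul_inv_cancel₀ hpos.ne'
  have hD0 := norm_nonneg D
  have hGD := mul_nonneg (norm_nonneg G) hD0
  have hHD := mul_nonneg (norm_nonneg H) hD0
  rw [add_mul, add_mul] at h1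
  have small : ∀ c : ℝ, c * ‖D‖ + ‖D‖ ≤ 1 → c * ‖D‖ < 1 := by
    intro c hc
    rcases hD0.eq_or_lt with h0 | h0
    · rw [← h0, mul_zero]
      exact one_pos
    · linarith
  exact ⟨hr.vadd A hD (small 2 (by linarith)),
    hG.vadd A hr.dense_domain hD (small _ (by linarith)),
    hH.vadd A hr.isClosed hD (small _ (by linarith))⟩
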